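/- Let $R$ and $S$ be arbitrary associative rings with identity. $\operatorname{Mod} R$ denotes the category of left $R$-modules, and right $S$-modules are identified with left $S^{op}$-modules. Let ${}_RC_S$ be a semidualizing $(R,S)$-bimodule, that is: ${}_RC$ has a projective resolution in $\operatorname{Mod} R$ and $C_S$ has a projective resolution in $\operatorname{Mod} S^{op}$, each with all terms finitely generated; the homothety maps $R\to \operatorname{Hom}_{S^{op}}(C,C)$, $r\mapsto(c\mapsto rc)$, and $S\to\operatorname{Hom}_R(C,C)$, $s\mapsto(c\mapsto cs)$, are isomorphisms; and $\operatorname{Ext}^i_R(C,C)=0=\operatorname{Ext}^i_{S^{op}}(C,C)$ for all $i\ge 1$. Suppose that ${}_RC$ has an ultimately closed projective resolution: there are a projective resolution $$\cdots\to P_n\xrightarrow{g_n}\cdots\xrightarrow{g_2} P_1\xrightarrow{g_1}P_0\xrightarrow{g_0}C\to 0$$ in $\operatorname{Mod} R$, an integer $n\ge 1$ and an isomorphism $\operatorname{Im} g_n\cong\bigoplus_j W_j$ in which each $W_j$ is isomorphic to a direct summand of some $\operatorname{Im} g_{i_j}$ with $0\le i_j<n$. Then $$\mathcal A_C(S)=C_S^{\top}={}^{\perp}\mathcal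 I_C(S)$$ as classes of left $S$-modules, where: * the Auslander class $\mathcal A_C(S)$ consists of the $N\in\operatorname{Mod} S$ such that $\operatorname{Tor}^S_i(C,N)=0$ and $\operatorname{Ext}_R^i(C,C\otimes_SN)=0$ for all $i\ge1$, and the map $\mu_N:N\to\operatorname{Hom}_R(C,C\otimes_SN)$, $\mu_N(x)(c)=c\otimes x$, is an isomorphism; * $C_S^{\top}=\{A\in\operatorname{Mod} S\mid \operatorname{Tor}^S_i(C,A)=0\text{ for all }i\ge1\}$; * $\mathcal I_C(S)$ is the class of $C$-injective modules, i.e. of the left $S$-modules isomorphic to $\operatorname{Hom}_R(C,I)$ for some injective $I\in\operatorname{Mod} R$, where $\operatorname{Hom}_R(C,I)$ carries the $S$-module structure $(sf)(c)=f(cs)$; * ${}^{\perp}\mathcal I_C(S)=\{A\in\operatorname{Mod} S\mid\operatorname{Ext}^i_S(A,X)=0\text{ for all }X\in\mathcal I_C(S)\text{ and all }i\ge1\}$. -/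

import Mathlib

open CategoryTheory CategoryTheory.Limits
open scoped TensorProduct DirectSum

universe u

set_option linter.unusedSectionVars false

/-! Conventions: an `(R, S)`-bimodule `C` is an additive group with commuting actions of `R` (left
action) and of `Sᵐᵒᵖ` (right action of `S`).  Left modules over `R` are the objects of
`ModuleCat R`, right modules over `S` are the objects of `ModuleCat Sᵐᵒᵖ`. -/

/-! ### The tensor product over a noncommutative ring -/

section Tensor

variable (R S : Type u) [Ring R] [Ring S]
variable (C : Type u) [AddCommGroup C] [Module R C] [Module Sᵐᵒᵖ C] [SMulCommClass R Sᵐᵒᵖ C]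

/-- The elements `(c s) ⊗ x - c ⊗ (s x)` of `C ⊗ N` (tensor product of abelian groups). -/
def balancingRelations (N : Type u) [AddCommGroup N] [Module S N] : Set (C ⊗[ℤ] N) :=
  {t | ∃ (c : C) (s : S) (x : N), t = (MulOpposite.op s • c) ⊗ₜ[ℤ] x - c ⊗ₜ[ℤ] (s • x)}

/-- The `R`-submodule of `C ⊗ N` spanned by the balancing relations.  It is equal to the additive
subgroup generated by them, see `balancingSubmodule_toAddSubgroup`. -/
def balancingSubmodule (N : Type u) [AddCommGroup N] [Module S N] : Submodule R (C ⊗[ℤ] N) :=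
  Submodule.span R (balancingRelations S C N)

theorem balancingSubmodule_toAddSubgroup (N : Type u) [AddCommGroup N] [Module S N] :
    (balancingSubmodule R S C N).toAddSubgroup =
      AddSubgroup.closure (balancingRelations S C N) := by
  apply le_antisymm
  · intro t ht
    refine Submodule.span_induction (p := fun t _ => t ∈ AddSubgroup.closure
      (balancingRelations S C N)) (fun t ht => AddSubgroup.subset_closure ht)
      (zero_mem _) (fun _ _ _ _ h₁ h₂ => add_mem h₁ h₂) (fun r t _ h => ?_) ht
    refine AddSubgroup.closure_induction (p := fun t _ => r • t ∈ AddSubgroup.closure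
      (balancingRelations S C N)) ?_ ?_ ?_ ?_ h
    · rintro _ ⟨c, s, x, rfl⟩
      refine AddSubgroup.subset_closure ⟨r • c, s, x, ?_⟩
      rw [smul_sub, TensorProduct.smul_tmul', TensorProduct.smul_tmul', smul_comm r]
    · simp
    · intro _ _ _ _ h₁ h₂
      rw [smul_add]
      exact add_mem h₁ h₂
    · intro _ _ h
      rw [smul_neg]
      exact neg_mem h
  · rw [AddSubgroup.closure_le]
    exact Submodule.subset_span

/-- The tensor product `C ⊗_S N` of an `(R, S)`-bimodule with a left `S`-module, with its left
`R`-module structure. -/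
abbrev TensorOver (N : Type u) [AddCommGroup N] [Module S N] : Type u :=
  (C ⊗[ℤ] N) ⧸ balancingSubmodule R S C N

namespace TensorOver

variable {C} in
/-- The element `c ⊗ x` of `C ⊗_S N`. -/
def tmul {N : Type u} [AddCommGroup N] [Module S N] (c : C) (x : N) : TensorOver R S C N :=
  (balancingSubmodule R S C N).mkQ (c ⊗ₜ[ℤ] x)

variable {C} in
theorem smul_tmul {N : Type u} [AddCommGroup N] [Module S N] (c : C) (s : S) (x : N) :
    tmul R S (MulOpposite.op s • c) x = tmul R S c (s • x) :=
  (Submodule.Quotient.eq _).2 (Submodule.subset_span ⟨c, s, x, rfl⟩)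

variable {S} in
/-- The `R`-linear map `C ⊗_S f`, sending `c ⊗ x` to `c ⊗ f x`. -/
def map {N N' : Type u} [AddCommGroup N] [Module S N] [AddCommGroup N'] [Module S N']
    (f : N →ₗ[S] N') : TensorOver R S C N →ₗ[R] TensorOver R S C N' :=
  Submodule.mapQ _ _
    (TensorProduct.AlgebraTensorModule.map (LinearMap.id : C →ₗ[R] C) f.toAddMonoidHom.toIntLinearMap)
    (by
      rw [balancingSubmodule, Submodule.span_le]
      rintro _ ⟨c, s, x, rfl⟩
      refine Submodule.subset_span ⟨c, s, f x, ?_⟩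
      simp)

variable {S} in
theorem map_tmul {N N' : Type u} [AddCommGroup N] [Module S N] [AddCommGroup N'] [Module S N']
    (f : N →ₗ[S] N') (c : C) (x : N) : map R C f (tmul R S c x) = tmul R S c (f x) := rfl

variable {S C} in
theorem hom_ext {N : Type u} [AddCommGroup N] [Module S N] {M : Type u} [AddCommGroup M]
    [Module R M] {f g : TensorOver R S C N →ₗ[R] M}
    (h : ∀ (c : C) (x : N), f (tmul R S c x) = g (tmul R S c x)) : f = g := by
  apply Submodule.linearMap_qext
  exact TensorProduct.AlgebraTensorModule.ext h

end TensorOver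

/-- The functor `C ⊗_S - : Mod S ⥤ Mod R`. -/
def tensorFunctor : ModuleCat.{u} S ⥤ ModuleCat.{u} R where
  obj N := ModuleCat.of R (TensorOver R S C N)
  map f := ModuleCat.ofHom (TensorOver.map R C f.hom)
  map_id N := by
    ext : 1
    exact TensorOver.hom_ext R fun c x => rfl
  map_comp f g := by
    ext : 1
    exact TensorOver.hom_ext R fun c x => rfl

instance tensorFunctor_additive : (tensorFunctor R S C).Additive where
  map_add {N N' f g} := by
    ext : 1
    refine TensorOver.hom_ext R fun c x => ?_
    change (balancingSubmodule R S C N').mkQ (c ⊗ₜ[ℤ] (f.hom x + g.hom x)) = _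
    rw [TensorProduct.tmul_add, map_add]
    rfl

/-- `Tor_i^S(C, N)`, the `i`-th left derived functor of `C ⊗_S -` at `N` (with the `R`-module
structure induced by the one of `C`). -/
noncomputable def torOver (i : ℕ) (N : ModuleCat.{u} S) : ModuleCat.{u} R :=
  ((tensorFunctor R S C).leftDerived i).obj N

/-- The class of left `S`-modules `A` such that `Tor_i^S(C, A) = 0` for all `i ≥ 1`. -/
def torOrthogonal : ObjectProperty (ModuleCat.{u} S) :=
  fun A => ∀ i : ℕ, 1 ≤ i → IsZero (torOver R S C i A)

end Tensor

/-! ### The left `S`-module `Hom_R(C, M)` -/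

section Hom

/-- The abelian group `Hom_R(C, M)`; for an `(R, S)`-bimodule `C` it is given the left `S`-module
structure `(s f)(c) = f(c s)` below. -/
def HomFrom (R : Type u) [Ring R] (C : Type u) [AddCommGroup C] [Module R C]
    (M : Type u) [AddCommGroup M] [Module R M] : Type u := C →ₗ[R] M

instance HomFrom.instAddCommGroup (R : Type u) [Ring R] (C : Type u) [AddCommGroup C] [Module R C]
    (M : Type u) [AddCommGroup M] [Module R M] : AddCommGroup (HomFrom R C M) :=
  inferInstanceAs (AddCommGroup (C →ₗ[R] M))

variable (R S : Type u) [Ring R] [Ring S]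
variable (C : Type u) [AddCommGroup C] [Module R C] [Module Sᵐᵒᵖ C] [SMulCommClass R Sᵐᵒᵖ C]

/-- The homothety `C → C`, `c ↦ r c`, as a homomorphism of right `S`-modules. -/
def leftHomothety (r : R) : C →ₗ[Sᵐᵒᵖ] C where
  toFun c := r • c
  map_add' := smul_add r
  map_smul' s c := smul_comm r s c

/-- The homothety `C → C`, `c ↦ c s`, as a homomorphism of left `R`-modules. -/
def rightHomothety (s : S) : C →ₗ[R] C where
  toFun c := MulOpposite.op s • c
  map_add' := smul_add (MulOpposite.op s)
  map_smul' r c := (smul_comm r (MulOpposite.op s) c).symm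

instance HomFrom.instModule (M : Type u) [AddCommGroup M] [Module R M] : Module S (HomFrom R C M) where
  smul s f := LinearMap.comp (f : C →ₗ[R] M) (rightHomothety R S C s)
  one_smul f := LinearMap.ext fun c =>
    congrArg (DFunLike.coe (F := C →ₗ[R] M) f) (one_smul Sᵐᵒᵖ c)
  mul_smul s t f := LinearMap.ext fun c =>
    congrArg (DFunLike.coe (F := C →ₗ[R] M) f) (mul_smul (MulOpposite.op t) (MulOpposite.op s) c)
  smul_zero _ := LinearMap.ext fun _ => rfl
  smul_add _ _ _ := LinearMap.ext fun _ => rfl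
  add_smul s t f := LinearMap.ext fun c =>
    (congrArg (DFunLike.coe (F := C →ₗ[R] M) f)
      (add_smul (MulOpposite.op s) (MulOpposite.op t) c)).trans (map_add _ _ _)
  zero_smul f := LinearMap.ext fun c =>
    (congrArg (DFunLike.coe (F := C →ₗ[R] M) f) (zero_smul Sᵐᵒᵖ c)).trans (map_zero _)

/-- The class of `C`-injective left `S`-modules: those isomorphic to `Hom_R(C, I)` for some
injective left `R`-module `I`. -/
def cInjective : ObjectProperty (ModuleCat.{u} S) :=
  fun X => ∃ I : ModuleCat.{u} R, Injective I ∧ Nonempty (X ≅ ModuleCat.of S (HomFrom R C I))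

/-- The canonical valuation homomorphism `μ_N : N → Hom_R(C, C ⊗_S N)`, `μ_N(x)(c) = c ⊗ x`. -/
def valuationHom (N : Type u) [AddCommGroup N] [Module S N] :
    N →ₗ[S] HomFrom R C (TensorOver R S C N) where
  toFun x :=
    ({ toFun := fun c => TensorOver.tmul R S c x
       map_add' := fun c c' => by
         simp only [TensorOver.tmul, TensorProduct.add_tmul, map_add]
       map_smul' := fun r c => rfl } : C →ₗ[R] TensorOver R S C N)
  map_add' x y := LinearMap.ext fun c => by
    change TensorOver.tmul R S c (x + y) = TensorOver.tmul R S c x + TensorOver.tmul R S c y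
    simp only [TensorOver.tmul, TensorProduct.tmul_add, map_add]
  map_smul' s x := LinearMap.ext fun c => (TensorOver.smul_tmul R S c s x).symm

end Hom

/-! ### Orthogonal classes, semidualizing bimodules, the Auslander class -/

/-- `Ext^i_R(M, N) = 0` for all `i ≥ 1`. -/
def ExtVanish {R : Type u} [Ring R] (M N : ModuleCat.{u} R) : Prop :=
  ∀ i : ℕ, 1 ≤ i → Subsingleton (Abelian.Ext.{u} M N i)

/-- The left `Ext`-orthogonal class of a class of modules. -/
def leftExtOrthogonal {S : Type u} [Ring S] (𝒳 : ObjectProperty (ModuleCat.{u} S)) :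
    ObjectProperty (ModuleCat.{u} S) :=
  fun A => ∀ X : ModuleCat.{u} S, 𝒳 X → ExtVanish A X

/-- `X` has a projective resolution all of whose terms are finitely generated. -/
def HasDegreewiseFiniteResolution {R : Type u} [Ring R] (X : ModuleCat.{u} R) : Prop :=
  ∃ P : ProjectiveResolution X, ∀ i : ℕ, Module.Finite R (P.complex.X i)

section Semidualizing

variable (R S : Type u) [Ring R] [Ring S]
variable (C : Type u) [AddCommGroup C] [Module R C] [Module Sᵐᵒᵖ C] [SMulCommClass R Sᵐᵒᵖ C]

/-- Semidualizing bimodules. -/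
structure IsSemidualizing : Prop where
  finite_left : HasDegreewiseFiniteResolution (ModuleCat.of R C)
  finite_right : HasDegreewiseFiniteResolution (ModuleCat.of Sᵐᵒᵖ C)
  homothety_left : Function.Bijective (leftHomothety R S C)
  homothety_right : Function.Bijective (rightHomothety R S C)
  ext_left : ExtVanish (ModuleCat.of R C) (ModuleCat.of R C)
  ext_right : ExtVanish (ModuleCat.of Sᵐᵒᵖ C) (ModuleCat.of Sᵐᵒᵖ C)

/-- The Auslander class `𝒜_C(S)` in `Mod S`. -/
structure IsAuslander (N : ModuleCat.{u} S) : Prop where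
  tor : torOrthogonal R S C N
  ext : ExtVanish (ModuleCat.of R C) (ModuleCat.of R (TensorOver R S C N))
  valuation : Function.Bijective (valuationHom R S C N)

/-- The Auslander class `𝒜_C(S)` as a class of left `S`-modules. -/
def auslanderClass : ObjectProperty (ModuleCat.{u} S) := IsAuslander R S C

end Semidualizing

/-! ### Ultimately closed projective resolutions -/

section UltimatelyClosed

variable {R : Type u} [Ring R]

/-- The images `Im g_i` of the maps in a projective resolution
`⋯ → P_1 --g_1--> P_0 --g_0--> X → 0`. -/
noncomputable def resolutionImage {X : ModuleCat.{u} R} (P : ProjectiveResolution X) :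
    ℕ → ModuleCat.{u} R
  | 0 => image (P.π.f 0)
  | i + 1 => image (P.complex.d (i + 1) i)

/-- `X` has an ultimately closed projective resolution at `n`: for some projective resolution,
`Im g_n` is isomorphic to a direct sum of modules `W_j`, each of which is isomorphic to a direct
summand of some `Im g_i` with `i < n`. -/
def HasUltimatelyClosedResolutionAt (X : ModuleCat.{u} R) (n : ℕ) : Prop :=
  1 ≤ n ∧ ∃ (P : ProjectiveResolution X) (J : Type u) (W : J → ModuleCat.{u} R),
    Nonempty (resolutionImage P n ≅ ModuleCat.of R (⨁ j, W j)) ∧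
    ∀ j, ∃ i < n, ∃ V : ModuleCat.{u} R, Nonempty (resolutionImage P i ≅ W j ⊞ V)

/-- `X` has an ultimately closed projective resolution. -/
def HasUltimatelyClosedResolution (X : ModuleCat.{u} R) : Prop :=
  ∃ n : ℕ, HasUltimatelyClosedResolutionAt X n

end UltimatelyClosed

/-! ### Dimension shifting for `Ext` -/

section DimensionShifting

open Abelian

universe w v' u'

variable {𝒞 : Type u'} [Category.{v'} 𝒞] [Abelian 𝒞] [HasExt.{w} 𝒞]

/-! The equality `C^⊤ = ^⊥ℐ_C(S)` is an adjunction argument. Maps `C ⊗ P_i → I` are maps `P_i →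
Hom_R(C, I)`, and exactness of `C ⊗ P` can be tested against injectives `I`, so `Tor_i(C, A) = 0`
iff `Ext^i(A, Hom_R(C, I)) = 0` for all injective `I` (`isZero_torOver_iff_ext`).

The Auslander class lies in `C^⊤` by definition. For the converse, take `N` in the common class and
`0 → N₁ → F → N → 0` with `F` free. The sequence stays exact after `C ⊗ -`, and `N₁` is again in the
class. Since `C` has a degreewise finite resolution, `F` behaves like `S`: `μ_F` is bijective and
`Ext^i(C, C ⊗ F) = 0` for `i ≥ 1`. Comparing the sequence with its image under `Hom_R(C, C ⊗ -)`
gives: `μ_{N₁}` is injective; `μ_N` is injective iff `μ_{N₁}` is surjective; `μ_N` is surjective iff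
`Ext^1(C, C ⊗ N₁) = 0`; and `Ext^i(C, C ⊗ N)` vanishes iff `Ext^{i+1}(C, C ⊗ N₁)` does.

Hence `μ` is bijective on every second syzygy. If `μ_N` is bijective, an `n`-th syzygy `N'` of `N`
has `Ext^i(C, C ⊗ N') = 0` for `1 ≤ i ≤ n`; ultimate closedness at `n` extends this to all `i ≥ 1`,
and shifting back gives `Ext^i(C, C ⊗ N) = 0`. So second syzygies are in the Auslander class, and
membership descends from `N₁` to `N` (`isAuslander_of_syzygy`). -/

theorem ext_subsingleton_of_retract {W M K : 𝒞} {n : ℕ} (i : W ⟶ M) (r : M ⟶ W)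
    (h : i ≫ r = 𝟙 W) [hM : Subsingleton (Ext.{w} M K n)] : Subsingleton (Ext.{w} W K n) := by
  refine subsingleton_of_forall_eq 0 fun x => ?_
  have h0 : (Ext.mk₀ r).comp x (zero_add n) = 0 := Subsingleton.elim _ _
  have h1 : (Ext.mk₀ i).comp ((Ext.mk₀ r).comp x (zero_add n)) (zero_add n) = x := by
    rw [Ext.mk₀_comp_mk₀_assoc, h, Ext.mk₀_id_comp]
  rw [← h1, h0, Ext.comp_zero]

variable {T : ShortComplex 𝒞} (hT : T.ShortExact)
include hT

theorem ext_contravariant_shift {K : 𝒞} {n : ℕ} [Subsingleton (Ext.{w} T.X₂ K n)]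
    [Subsingleton (Ext.{w} T.X₂ K (n + 1))] :
    Subsingleton (Ext.{w} T.X₃ K (n + 1)) ↔ Subsingleton (Ext.{w} T.X₁ K n) := by
  constructor
  · intro _
    refine subsingleton_of_forall_eq 0 fun x => ?_
    obtain ⟨y, rfl⟩ := Ext.contravariant_sequence_exact₁ hT K x (add_comm 1 n)
      (Subsingleton.elim _ _)
    rw [Subsingleton.elim y 0, Ext.comp_zero]
  · intro _
    refine subsingleton_of_forall_eq 0 fun x => ?_
    obtain ⟨y, rfl⟩ := Ext.contravariant_sequence_exact₃ hT K x
      (Subsingleton.elim _ _) (add_comm 1 n)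
    rw [Subsingleton.elim y 0, Ext.comp_zero]

theorem ext_covariant_shift {K : 𝒞} {n : ℕ} [Subsingleton (Ext.{w} K T.X₂ n)]
    [Subsingleton (Ext.{w} K T.X₂ (n + 1))] :
    Subsingleton (Ext.{w} K T.X₁ (n + 1)) ↔ Subsingleton (Ext.{w} K T.X₃ n) := by
  constructor
  · intro _
    refine subsingleton_of_forall_eq 0 fun x => ?_
    obtain ⟨y, rfl⟩ := Ext.covariant_sequence_exact₃ K hT x rfl (Subsingleton.elim _ _)
    rw [Subsingleton.elim y 0, Ext.zero_comp]
  · intro _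
    refine subsingleton_of_forall_eq 0 fun x => ?_
    obtain ⟨y, rfl⟩ := Ext.covariant_sequence_exact₁ K hT x (Subsingleton.elim _ _) rfl
    rw [Subsingleton.elim y 0, Ext.zero_comp]

/-- The bottom case of the covariant shift: once `Ext^1(K, X₂) = 0`, the group `Ext^1(K, X₁)` is the
cokernel of `Hom(K, X₂) → Hom(K, X₃)`. -/
theorem ext_one_subsingleton_iff_lift {K : 𝒞} [Subsingleton (Ext.{w} K T.X₂ 1)] :
    Subsingleton (Ext.{w} K T.X₁ 1) ↔ ∀ f : K ⟶ T.X₃, ∃ g : K ⟶ T.X₂, g ≫ T.g = f := by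
  constructor
  · intro _ f
    obtain ⟨y, hy⟩ := Ext.covariant_sequence_exact₃ K hT (Ext.mk₀ f) (zero_add 1)
      (Subsingleton.elim _ _)
    obtain ⟨g, rfl⟩ := Ext.addEquiv₀.symm.surjective y
    refine ⟨g, ?_⟩
    apply Ext.addEquiv₀.symm.injective
    exact (Ext.mk₀_comp_mk₀ _ _).symm.trans hy
  · intro h
    refine subsingleton_of_forall_eq 0 fun x => ?_
    obtain ⟨y, rfl⟩ := Ext.covariant_sequence_exact₁ K hT x (Subsingleton.elim _ _) (zero_add 1)
    obtain ⟨f, rfl⟩ := Ext.addEquiv₀.symm.surjective y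
    obtain ⟨g, rfl⟩ := h f
    change (Ext.mk₀ (g ≫ T.g)).comp _ _ = 0
    rw [← Ext.mk₀_comp_mk₀, Ext.comp_assoc_of_second_deg_zero, hT.comp_extClass, Ext.comp_zero]

theorem ext_one_extend {K : 𝒞} [Subsingleton (Ext.{w} T.X₃ K 1)] (f : T.X₁ ⟶ K) :
    ∃ g : T.X₂ ⟶ K, T.f ≫ g = f := by
  obtain ⟨y, hy⟩ := Ext.contravariant_sequence_exact₁ hT K (Ext.mk₀ f) (add_zero 1)
    (Subsingleton.elim _ _)
  obtain ⟨g, rfl⟩ := Ext.addEquiv₀.symm.surjective y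
  refine ⟨g, ?_⟩
  apply Ext.addEquiv₀.symm.injective
  exact (Ext.mk₀_comp_mk₀ _ _).symm.trans hy

end DimensionShifting

/-! ### Vanishing of `Ext` for projective modules, injective modules and direct sums -/

section ModuleExt

open Abelian

variable {R : Type u} [Ring R]

theorem ext_subsingleton_of_projective {P : ModuleCat.{u} R} [Projective P] (K : ModuleCat.{u} R)
    {n : ℕ} (hn : 1 ≤ n) : Subsingleton (Ext.{u} P K n) := by
  obtain ⟨n, rfl⟩ := Nat.exists_eq_add_of_le' hn
  exact Ext.subsingleton_of_projective P K n

theorem ext_subsingleton_of_injective (K : ModuleCat.{u} R) {I : ModuleCat.{u} R} [Injective I]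
    {n : ℕ} (hn : 1 ≤ n) : Subsingleton (Ext.{u} K I n) := by
  obtain ⟨n, rfl⟩ := Nat.exists_eq_add_of_le' hn
  exact Ext.subsingleton_of_injective K I n

theorem shortExact_injective_embedding (K : ModuleCat.{u} R) :
    (ShortComplex.mk (Injective.ι K) (cokernel.π (Injective.ι K)) (by simp)).ShortExact where
  exact := ShortComplex.exact_cokernel _

/-- Embedding `K` in an injective and shifting reduces to degree 1, where vanishing is a lifting
property; lifts on the summands assemble to a lift on the direct sum. The induction changes `K`,
hence the quantifier after the colon. -/
theorem ext_directSum_subsingleton {J : Type u} (W : J → ModuleCat.{u} R) {n : ℕ} (hn : 1 ≤ n) :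
    ∀ K : ModuleCat.{u} R, (∀ j, Subsingleton (Ext.{u} (W j) K n)) →
      Subsingleton (Ext.{u} (ModuleCat.of R (⨁ j, W j)) K n) := by
  induction n, hn using Nat.le_induction with
  | base =>
    intro K hK
    have hI (X : ModuleCat.{u} R) : Subsingleton (Ext.{u} X (Injective.under K) 1) :=
      ext_subsingleton_of_injective X le_rfl
    refine (ext_one_subsingleton_iff_lift (shortExact_injective_embedding K)).2 fun f => ?_
    have h (j : J) := (ext_one_subsingleton_iff_lift (K := W j)
      (shortExact_injective_embedding K)).1 (hK j)
    classical
    choose g hg using fun j => h j (ModuleCat.ofHom (DirectSum.lof R J (fun j => W j) j) ≫ f)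
    let γ : (⨁ j, W j) →ₗ[R] (Injective.under K : ModuleCat.{u} R) :=
      DirectSum.toModule R J _ fun j => (ModuleCat.Hom.hom (g j) : W j →ₗ[R] _)
    have hγ (j : J) (x : W j) : γ (DirectSum.lof R J (fun j => W j) j x) = (g j).hom x :=
      DirectSum.toModule_lof (M := fun j => W j) R j x
    refine ⟨ModuleCat.ofHom γ, ?_⟩
    ext : 1
    refine DirectSum.linearMap_ext R fun j => ?_
    ext x
    refine Eq.trans ?_ congr($(hg j) x)
    exact congrArg (cokernel.π (Injective.ι K)).hom (hγ j x)
  | succ n hn ih =>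
    intro K hK
    have hI (X : ModuleCat.{u} R) : Subsingleton (Ext.{u} X (Injective.under K) n) :=
      ext_subsingleton_of_injective X hn
    have hI' (X : ModuleCat.{u} R) : Subsingleton (Ext.{u} X (Injective.under K) (n + 1)) :=
      ext_subsingleton_of_injective X (by omega)
    refine (ext_covariant_shift (shortExact_injective_embedding K)).2 (ih _ fun j => ?_)
    exact (ext_covariant_shift (shortExact_injective_embedding K)).1 (hK j)

end ModuleExt

/-! ### Ultimately closed resolutions -/

section UltimatelyClosed

open Abelian

variable {R : Type u} [Ring R] {X : ModuleCat.{u} R} (P : ProjectiveResolution X)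

theorem shortExact_resolutionImage (i : ℕ) : ∃ T : ShortComplex (ModuleCat.{u} R),
    T.ShortExact ∧ Projective T.X₂ ∧ T.X₁ = resolutionImage P (i + 1) ∧
      T.X₃ = resolutionImage P i := by
  -- A common form for the augmentation (`i = 0`) and the differentials (`i ≥ 1`).
  have key : ∀ {Z : ModuleCat.{u} R} (g : P.complex.X i ⟶ Z) (w : P.complex.d (i + 1) i ≫ g = 0),
      (ShortComplex.mk _ _ w).Exact →
      ∃ T : ShortComplex (ModuleCat.{u} R), T.ShortExact ∧ Projective T.X₂ ∧
        T.X₁ = image (P.complex.d (i + 1) i) ∧ T.X₃ = image g := by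
    intro Z g w hex
    have w1 : P.complex.d (i + 1) i ≫ factorThruImage g = 0 := by
      rw [← cancel_mono (Limits.image.ι g), Category.assoc, Limits.image.fac, w, zero_comp]
    have w2 : Limits.image.ι (P.complex.d (i + 1) i) ≫ factorThruImage g = 0 := by
      rw [← cancel_epi (factorThruImage (P.complex.d (i + 1) i)), Limits.image.fac_assoc, w1, comp_zero]
    -- Exactness in the middle is insensitive to a mono on the right term (`φ`) and to an epi on the
    -- left term (`ψ`).
    let A := ShortComplex.mk _ _ w1
    let φ : A ⟶ ShortComplex.mk _ _ w :=
      { τ₁ := 𝟙 _, τ₂ := 𝟙 _, τ₃ := Limits.image.ι g }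
    let ψ : A ⟶ ShortComplex.mk _ _ w2 :=
      { τ₁ := factorThruImage _, τ₂ := 𝟙 _, τ₃ := 𝟙 _ }
    have : Epi φ.τ₁ := inferInstanceAs (Epi (𝟙 _))
    have : IsIso φ.τ₂ := inferInstanceAs (IsIso (𝟙 _))
    have : Mono φ.τ₃ := inferInstanceAs (Mono (Limits.image.ι g))
    have : Epi ψ.τ₁ := inferInstanceAs (Epi (factorThruImage _))
    have : IsIso ψ.τ₂ := inferInstanceAs (IsIso (𝟙 _))
    have : Mono ψ.τ₃ := inferInstanceAs (Mono (𝟙 _))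
    have hA : A.Exact := (ShortComplex.exact_iff_of_epi_of_isIso_of_mono φ).2 hex
    refine ⟨ShortComplex.mk _ _ w2, ⟨(ShortComplex.exact_iff_of_epi_of_isIso_of_mono ψ).1 hA⟩,
      P.projective i, rfl, rfl⟩
  cases i with
  | zero => exact key (P.π.f 0) P.complex_d_comp_π_f_zero P.exact₀
  | succ i => exact key _ _ (P.exact_succ i)

/-- `Im g_i` is an `i`-th syzygy of `X`, with `Im g_0 ≅ X` because the augmentation is epi. Degree
`j ≥ 1` is needed for the projective middle terms to have no `Ext`. -/
theorem resolutionImage_ext_iff (K : ModuleCat.{u} R) (i : ℕ) : ∀ {j : ℕ}, 1 ≤ j →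
    (Subsingleton (Ext.{u} (resolutionImage P i) K j) ↔ Subsingleton (Ext.{u} X K (i + j))) := by
  induction i with
  | zero =>
    intro j hj
    have : Epi (Limits.image.ι (P.π.f 0)) := epi_image_of_epi _
    have : IsIso (Limits.image.ι (P.π.f 0)) := isIso_of_mono_of_epi _
    have e₀ := asIso (Limits.image.ι (P.π.f 0))
    have e : resolutionImage P 0 ≅ X := e₀ ≪≫ HomologicalComplex.singleObjXSelf _ _ _
    rw [zero_add]
    exact ⟨fun _ => ext_subsingleton_of_retract e.inv e.hom (by simp),
      fun _ => ext_subsingleton_of_retract e.hom e.inv (by simp)⟩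
  | succ i ih =>
    intro j hj
    obtain ⟨T, hT, hP, h₁, h₃⟩ := shortExact_resolutionImage P i
    have : Subsingleton (Ext.{u} T.X₂ K j) := ext_subsingleton_of_projective K hj
    have : Subsingleton (Ext.{u} T.X₂ K (j + 1)) := ext_subsingleton_of_projective K (by omega)
    rw [← h₁, ← ext_contravariant_shift hT, h₃, ih (by omega)]
    have : i + (j + 1) = i + 1 + j := by omega
    rw [this]

/-- Beyond degree `n`, `Ext^{n+k+1}(X, K)` is governed by `Ext^{k+1}(Im g_n, K)`, hence by the
groups `Ext^{k+1}(Im g_i, K)` with `i < n`, that is by `Ext^{i+k+1}(X, K)` in strictly smaller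
degree. -/
theorem extVanish_of_ultimatelyClosed {n : ℕ} (h : HasUltimatelyClosedResolutionAt X n)
    (K : ModuleCat.{u} R) (hK : ∀ j, 1 ≤ j → j ≤ n → Subsingleton (Ext.{u} X K j)) :
    ExtVanish X K := by
  obtain ⟨hn, P, J, W, ⟨e⟩, hW⟩ := h
  intro j
  induction j using Nat.strong_induction_on with
  | _ j ih =>
  intro hj
  rcases le_or_gt j n with hjn | hjn
  · exact hK j hj hjn
  obtain ⟨k, rfl⟩ := Nat.exists_eq_add_of_lt hjn
  have hk : 1 ≤ k + 1 := by omega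
  rw [add_assoc, ← resolutionImage_ext_iff P K n hk]
  have := ext_directSum_subsingleton W hk K fun j => by
    obtain ⟨i, hi, V, ⟨e'⟩⟩ := hW j
    have := (resolutionImage_ext_iff P K i hk).2 (ih _ (by omega) (by omega))
    exact ext_subsingleton_of_retract (biprod.inl ≫ e'.inv) (e'.hom ≫ biprod.fst) (by simp)
  exact ext_subsingleton_of_retract e.hom e.inv (by simp)

end UltimatelyClosed

/-! ### The tensor-hom adjunction -/

section Adjunction

variable (R S : Type u) [Ring R] [Ring S]
variable (C : Type u) [AddCommGroup C] [Module R C] [Module Sᵐᵒᵖ C] [SMulCommClass R Sᵐᵒᵖ C]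

variable {R C} in
/-- The underlying `R`-linear map of an element of `Hom_R(C, M)`. -/
def HomFrom.toLinearMap {M : Type u} [AddCommGroup M] [Module R M] (f : HomFrom R C M) :
    C →ₗ[R] M := f

namespace TensorOver

variable {R S C}
variable {N : Type u} [AddCommGroup N] [Module S N] {M : Type u} [AddCommGroup M] [Module R M]

/-- The `R`-linear map `C ⊗_S N → M` given by an `S`-linear map `N → Hom_R(C, M)`. -/
def lift (f : N →ₗ[S] HomFrom R C M) : TensorOver R S C N →ₗ[R] M :=
  Submodule.liftQ _
    (TensorProduct.AlgebraTensorModule.lift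
      ({ toFun c := AddMonoidHom.toIntLinearMap
            { toFun x := (f x).toLinearMap c
              map_zero' := by rw [map_zero]; rfl
              map_add' x y := by rw [map_add]; rfl }
         map_add' c c' := LinearMap.ext fun x => map_add (f x).toLinearMap c c'
         map_smul' r c := LinearMap.ext fun x => map_smul (f x).toLinearMap r c } :
        C →ₗ[R] N →ₗ[ℤ] M))
    (by
      rw [balancingSubmodule, Submodule.span_le]
      rintro _ ⟨c, s, x, rfl⟩
      change _ = _
      rw [map_sub, sub_eq_zero]
      change (f x).toLinearMap (MulOpposite.op s • c) = (f (s • x)).toLinearMap c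
      rw [f.map_smul]
      rfl)

theorem lift_tmul (f : N →ₗ[S] HomFrom R C M) (c : C) (x : N) :
    lift f (tmul R S c x) = (f x).toLinearMap c := rfl

/-- The `S`-linear map `N → Hom_R(C, M)` given by an `R`-linear map `C ⊗_S N → M`. -/
def curry (φ : TensorOver R S C N →ₗ[R] M) : N →ₗ[S] HomFrom R C M where
  toFun x := φ.comp (valuationHom R S C N x).toLinearMap
  map_add' x y := by
    rw [map_add]
    exact LinearMap.comp_add _ _ φ
  map_smul' s x := by
    rw [map_smul]
    rfl

theorem lift_curry (φ : TensorOver R S C N →ₗ[R] M) : lift (curry φ) = φ :=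
  hom_ext R fun _ _ => rfl

theorem curry_lift (f : N →ₗ[S] HomFrom R C M) : curry (lift f) = f := rfl

theorem curry_injective :
    Function.Injective (curry : (TensorOver R S C N →ₗ[R] M) → (N →ₗ[S] HomFrom R C M)) :=
  Function.LeftInverse.injective lift_curry

theorem curry_comp_map {N' : Type u} [AddCommGroup N'] [Module S N']
    (φ : TensorOver R S C N →ₗ[R] M) (h : N' →ₗ[S] N) :
    curry (φ ∘ₗ map R C h) = curry φ ∘ₗ h := rfl

theorem map_surjective {N' : Type u} [AddCommGroup N'] [Module S N'] (g : N →ₗ[S] N')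
    (hg : Function.Surjective g) : Function.Surjective (map R C g) := by
  -- Surjectivity is read as the vanishing of the projection onto the quotient by the range, which
  -- can be checked on pure tensors.
  rw [← LinearMap.range_eq_top, ← Submodule.ker_mkQ (LinearMap.range (map R C g)),
    LinearMap.ker_eq_top]
  refine hom_ext R fun c x => ?_
  obtain ⟨y, rfl⟩ := hg x
  exact (Submodule.Quotient.mk_eq_zero _).2 ⟨tmul R S c y, rfl⟩

/-- Let `q` be the projection onto the cokernel of `C ⊗ f`. Its adjoint kills `ker g`, so it factors
through `g`; by adjunction `q` factors through `C ⊗ g` and vanishes on its kernel. -/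
theorem map_exact {N' N'' : Type u} [AddCommGroup N'] [Module S N'] [AddCommGroup N'']
    [Module S N''] (f : N' →ₗ[S] N) (g : N →ₗ[S] N'') (hfg : Function.Exact f g)
    (hg : Function.Surjective g) (t : TensorOver R S C N) (ht : map R C g t = 0) :
    ∃ t', map R C f t' = t := by
  let q := (LinearMap.range (map R C f)).mkQ
  have hker : LinearMap.ker g ≤ LinearMap.ker (curry q) := by
    intro x hx
    obtain ⟨y, rfl⟩ := (hfg x).1 hx
    exact LinearMap.ext fun c => (Submodule.Quotient.mk_eq_zero _).2 ⟨tmul R S c y, rfl⟩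
  let k : N'' →ₗ[S] HomFrom R C _ :=
    (LinearMap.ker g).liftQ (curry q) hker ∘ₗ (g.quotKerEquivOfSurjective hg).symm.toLinearMap
  have hk : k ∘ₗ g = curry q := by
    ext x : 1
    change (LinearMap.ker g).liftQ (curry q) hker ((g.quotKerEquivOfSurjective hg).symm (g x)) = _
    have : (g.quotKerEquivOfSurjective hg).symm (g x) = (LinearMap.ker g).mkQ x := by
      rw [LinearEquiv.symm_apply_eq]
      rfl
    rw [this]
    exact (LinearMap.ker g).liftQ_apply _ x
  have hq : lift k ∘ₗ map R C g = q := curry_injective (by rw [curry_comp_map, curry_lift, hk])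
  have : q t = 0 := by rw [← hq, LinearMap.comp_apply, ht, map_zero]
  exact (Submodule.Quotient.mk_eq_zero _).1 this

end TensorOver

end Adjunction

/-! ### `Tor`-vanishing as `Ext`-vanishing against `C`-injective modules -/

section TorExt

open Abelian

theorem exact_iff_extends_to_injectives {R : Type u} [Ring R]
    (T : ShortComplex (ModuleCat.{u} R)) :
    T.Exact ↔ ∀ I : ModuleCat.{u} R, Injective I → ∀ h : T.X₂ ⟶ I, T.f ≫ h = 0 →
      ∃ k : T.X₃ ⟶ I, T.g ≫ k = h := by
  constructor
  · intro hT I _ h w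
    exact ⟨hT.descToInjective h w, hT.comp_descToInjective h w⟩
  · intro H
    -- The test map is the cokernel of `T.f` embedded in an injective.
    obtain ⟨k, hk⟩ := H (Injective.under (cokernel T.f)) inferInstance
      (cokernel.π T.f ≫ Injective.ι _) (by simp)
    rw [ShortComplex.exact_iff_kernel_ι_comp_cokernel_π_zero,
      ← cancel_mono (Injective.ι (cokernel T.f)), Category.assoc, ← hk, kernel.condition_assoc,
      zero_comp, zero_comp]

/-- Classes in `Ext^{i+1}` are cocycles on `P_{i+1}` modulo coboundaries from `P_i`. -/
theorem ext_subsingleton_iff_extends {S : Type u} [Ring S] {A : ModuleCat.{u} S}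
    (P : ProjectiveResolution A) (X : ModuleCat.{u} S) (i : ℕ) :
    Subsingleton (Ext.{u} A X (i + 1)) ↔
      ∀ h : P.complex.X (i + 1) ⟶ X, P.complex.d (i + 2) (i + 1) ≫ h = 0 →
        ∃ k : P.complex.X i ⟶ X, P.complex.d (i + 1) i ≫ k = h := by
  constructor
  · intro _ h w
    exact (P.extMk_eq_zero_iff h (i + 2) rfl w i rfl).1 (Subsingleton.elim _ _)
  · intro H
    refine subsingleton_of_forall_eq 0 fun x => ?_
    obtain ⟨h, w, rfl⟩ := P.extMk_surjective x (i + 2) rfl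
    exact (P.extMk_eq_zero_iff h (i + 2) rfl w i rfl).2 (H h w)

theorem ext_subsingleton_of_target_iso {S : Type u} [Ring S] {A X Y : ModuleCat.{u} S} (e : X ≅ Y)
    {n : ℕ} [Subsingleton (Ext.{u} A X n)] : Subsingleton (Ext.{u} A Y n) := by
  refine subsingleton_of_forall_eq 0 fun x => ?_
  have h0 : x.comp (Ext.mk₀ e.inv) (add_zero n) = 0 := Subsingleton.elim _ _
  have h1 : (x.comp (Ext.mk₀ e.inv) (add_zero n)).comp (Ext.mk₀ e.hom) (add_zero n) = x := by
    rw [Ext.comp_assoc_of_second_deg_zero, Ext.mk₀_comp_mk₀, e.inv_hom_id, Ext.comp_mk₀_id]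
  rw [← h1, h0, Ext.zero_comp]

variable (R S : Type u) [Ring R] [Ring S]
variable (C : Type u) [AddCommGroup C] [Module R C] [Module Sᵐᵒᵖ C] [SMulCommClass R Sᵐᵒᵖ C]

theorem isZero_torOver_iff {A : ModuleCat.{u} S} (P : ProjectiveResolution A) (i : ℕ) :
    IsZero (torOver R S C (i + 1) A) ↔
      ((ShortComplex.mk _ _ (P.complex.d_comp_d (i + 2) (i + 1) i)).map
        (tensorFunctor R S C)).Exact := by
  rw [torOver, (P.isoLeftDerivedObj (tensorFunctor R S C) (i + 1)).isZero_iff]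
  change IsZero (HomologicalComplex.homology _ (i + 1)) ↔ _
  rw [← HomologicalComplex.exactAt_iff_isZero_homology,
    HomologicalComplex.exactAt_iff' _ (i + 2) (i + 1) i (by simp) (by simp)]
  rfl

theorem isZero_torOver_iff_ext {A : ModuleCat.{u} S} (i : ℕ) :
    IsZero (torOver R S C (i + 1) A) ↔ ∀ I : ModuleCat.{u} R, Injective I →
      Subsingleton (Ext.{u} A (ModuleCat.of S (HomFrom R C I)) (i + 1)) := by
  let P := projectiveResolution A
  rw [isZero_torOver_iff R S C P, exact_iff_extends_to_injectives]
  refine forall_congr' fun I => forall_congr' fun _ => ?_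
  rw [ext_subsingleton_iff_extends P]
  constructor
  · intro H h w
    obtain ⟨k, hk⟩ := H (ModuleCat.ofHom (TensorOver.lift h.hom)) (by
      ext : 1
      apply TensorOver.curry_injective
      exact congrArg ModuleCat.Hom.hom w)
    refine ⟨ModuleCat.ofHom (TensorOver.curry k.hom), ?_⟩
    ext : 1
    exact congrArg (fun φ => TensorOver.curry (ModuleCat.Hom.hom φ)) hk
  · intro H h w
    obtain ⟨k, hk⟩ := H (ModuleCat.ofHom (TensorOver.curry h.hom)) (by
      ext : 1
      exact congrArg (fun φ => TensorOver.curry (ModuleCat.Hom.hom φ)) w)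
    refine ⟨ModuleCat.ofHom (TensorOver.lift k.hom), ?_⟩
    ext : 1
    apply TensorOver.curry_injective
    exact congrArg ModuleCat.Hom.hom hk

theorem torOrthogonal_eq_leftExtOrthogonal_cInjective :
    torOrthogonal R S C = leftExtOrthogonal (cInjective R S C) := by
  ext A
  constructor
  · rintro hA X ⟨I, hI, ⟨e⟩⟩ i hi
    obtain ⟨i, rfl⟩ := Nat.exists_eq_add_of_le' hi
    have := (isZero_torOver_iff_ext R S C i).1 (hA _ hi) I hI
    exact ext_subsingleton_of_target_iso e.symm
  · intro hA i hi
    obtain ⟨i, rfl⟩ := Nat.exists_eq_add_of_le' hi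
    exact (isZero_torOver_iff_ext R S C i).2 fun I hI => hA _ ⟨I, hI, ⟨Iso.refl _⟩⟩ _ hi

end TorExt

/-! ### Tensoring with free modules -/

section Free

open Abelian

theorem exists_support_subset_of_finite {R M J C : Type u} [Ring R] [AddCommGroup M] [Module R M]
    [Module.Finite R M] [AddCommGroup C] [Module R C] (f : M →ₗ[R] (J →₀ C)) :
    ∃ F : Finset J, ∀ x, (f x).support ⊆ F := by
  classical
  obtain ⟨G, hG⟩ := Module.Finite.fg_top (R := R) (M := M)
  refine ⟨G.biUnion fun x => (f x).support, fun x => ?_⟩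
  have hx : x ∈ Submodule.span R (G : Set M) := hG ▸ Submodule.mem_top
  induction hx using Submodule.span_induction with
  | mem x hx => exact Finset.subset_biUnion_of_mem (fun x => (f x).support) hx
  | zero => simp
  | add x y _ _ hx hy =>
    rw [map_add]
    exact Finsupp.support_add.trans (Finset.union_subset hx hy)
  | smul r x _ hx =>
    rw [map_smul]
    exact Finsupp.support_smul.trans hx

theorem sum_single_apply_of_support_subset {J C : Type u} [AddCommGroup C] (F : Finset J)
    (v : J →₀ C) (hv : v.support ⊆ F) : ∑ j ∈ F, Finsupp.single j (v j) = v :=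
  (Finsupp.sum_of_support_subset v hv _ (by simp)).symm.trans v.sum_single

/-- A cocycle on a finitely generated `P_{i+1}` has only finitely many nonzero coordinates. Each one
bounds separately, and the finite sum of the solutions is a map into `C^(J)`. -/
theorem extVanish_finsupp {R : Type u} [Ring R] {X : ModuleCat.{u} R}
    (hX : HasDegreewiseFiniteResolution X) {C : Type u} [AddCommGroup C] [Module R C]
    (hC : ExtVanish X (ModuleCat.of R C)) (J : Type u) :
    ExtVanish X (ModuleCat.of R (J →₀ C)) := by
  obtain ⟨P, hP⟩ := hX
  intro i hi
  obtain ⟨i, rfl⟩ := Nat.exists_eq_add_of_le' hi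
  refine (ext_subsingleton_iff_extends P _ i).2 fun h w => ?_
  have hC' := (ext_subsingleton_iff_extends P _ i).1 (hC _ hi)
  obtain ⟨F, hF⟩ := exists_support_subset_of_finite h.hom
  choose k hk using fun j => hC' (h ≫ ModuleCat.ofHom (Finsupp.lapply j))
    (by rw [← Category.assoc, w, zero_comp])
  refine ⟨ModuleCat.ofHom (∑ j ∈ F, (Finsupp.lsingle j).comp (k j).hom), ?_⟩
  ext x : 2
  have hx (j : J) : (k j).hom ((P.complex.d (i + 1) i).hom x) = (h.hom x) j := congr($(hk j) x)
  change (∑ j ∈ F, (Finsupp.lsingle (R := R) j).comp (k j).hom)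
    ((P.complex.d (i + 1) i).hom x) = h.hom x
  rw [LinearMap.sum_apply]
  refine Eq.trans (Finset.sum_congr rfl fun j _ => ?_)
    (sum_single_apply_of_support_subset F (h.hom x) (hF x))
  rw [LinearMap.comp_apply, hx]
  rfl

theorem finite_of_hasDegreewiseFiniteResolution {R : Type u} [Ring R] {X : ModuleCat.{u} R}
    (hX : HasDegreewiseFiniteResolution X) : Module.Finite R X := by
  obtain ⟨P, hP⟩ := hX
  have := hP 0
  let g : P.complex.X 0 ⟶ X := P.π.f 0 ≫ (HomologicalComplex.singleObjXSelf _ _ _).hom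
  have : Epi g := epi_comp _ _
  exact Module.Finite.of_surjective g.hom ((ModuleCat.epi_iff_surjective g).1 this)

variable (R S : Type u) [Ring R] [Ring S]
variable (C : Type u) [AddCommGroup C] [Module R C] [Module Sᵐᵒᵖ C] [SMulCommClass R Sᵐᵒᵖ C]

/-- The map `S^(J) → Hom_R(C, C^(J))` adjoint to `C ⊗_S S^(J) ≃ C^(J)`. -/
noncomputable def finsuppToHom (J : Type u) : (J →₀ S) →ₗ[S] HomFrom R C (J →₀ C) where
  toFun x :=
    ({ toFun c := x.mapRange (fun s => MulOpposite.op s • c) (by simp)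
       map_add' c c' := by ext; simp
       map_smul' r c := by ext; simp [smul_comm r] } : C →ₗ[R] (J →₀ C))
  map_add' x y := LinearMap.ext fun c => Finsupp.ext fun j => by
    change MulOpposite.op ((x + y) j) • c = MulOpposite.op (x j) • c + MulOpposite.op (y j) • c
    rw [Finsupp.add_apply, MulOpposite.op_add, add_smul]
  map_smul' s x := LinearMap.ext fun c => Finsupp.ext fun j => by
    change MulOpposite.op ((s • x) j) • c = MulOpposite.op (x j) • MulOpposite.op s • c
    rw [Finsupp.smul_apply, smul_eq_mul, MulOpposite.op_mul, mul_smul]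

theorem finsuppToHom_apply {J : Type u} (x : J →₀ S) (c : C) (j : J) :
    (finsuppToHom R S C J x).toLinearMap c j = MulOpposite.op (x j) • c := rfl

theorem TensorOver.tmul_sum {N : Type u} [AddCommGroup N] [Module S N] {J : Type u}
    (F : Finset J) (c : C) (x : J → N) :
    tmul R S c (∑ j ∈ F, x j) = ∑ j ∈ F, tmul R S c (x j) := by
  simp only [tmul, TensorProduct.tmul_sum, map_sum]

/-- The isomorphism `C ⊗_S S^(J) ≃ C^(J)`. -/
noncomputable def tensorFinsuppEquiv (J : Type u) : TensorOver R S C (J →₀ S) ≃ₗ[R] (J →₀ C) :=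
  LinearEquiv.ofLinearMap (TensorOver.lift (finsuppToHom R S C J))
    -- The inverse sends `c` in position `j` to `c ⊗ e_j`.
    (Finsupp.lsum ℕ fun j => (valuationHom R S C (J →₀ S) (Finsupp.single j 1)).toLinearMap)
    (by
      refine Finsupp.lhom_ext fun j c => ?_
      rw [LinearMap.comp_apply, Finsupp.lsum_single]
      change (finsuppToHom R S C J _).toLinearMap c = Finsupp.single j c
      ext i
      rw [finsuppToHom_apply]
      classical
      by_cases h : j = i
      · subst h
        simp
      · simp [h])
    (by
      refine TensorOver.hom_ext R fun c x => ?_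
      rw [LinearMap.comp_apply, TensorOver.lift_tmul]
      change Finsupp.sum (Finsupp.mapRange (fun s : S => MulOpposite.op s • c) (by simp) x) _ = TensorOver.tmul R S c x
      rw [Finsupp.sum_mapRange_index (fun j => map_zero _)]
      conv_rhs => rw [← x.sum_single, Finsupp.sum, TensorOver.tmul_sum]
      refine Finset.sum_congr rfl fun j _ => ?_
      change TensorOver.tmul R S (MulOpposite.op (x j) • c) (Finsupp.single j 1) = _
      rw [TensorOver.smul_tmul, Finsupp.smul_single, smul_eq_mul, mul_one])

theorem tensorFinsuppEquiv_tmul {J : Type u} (c : C) (x : J →₀ S) (j : J) :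
    tensorFinsuppEquiv R S C J (TensorOver.tmul R S c x) j = MulOpposite.op (x j) • c := rfl

variable {R S C}

/-- Coordinatewise this is the bijectivity of `S → Hom_R(C, C)`; finite generation of `C` confines a
map `C → C^(J)` to finitely many coordinates. -/
theorem valuationHom_finsupp_bijective (hC : IsSemidualizing R S C) (J : Type u) :
    Function.Bijective (valuationHom R S C (J →₀ S)) := by
  constructor
  · intro x y hxy
    ext j
    refine hC.homothety_right.1 (LinearMap.ext fun c => ?_)
    change MulOpposite.op (x j) • c = MulOpposite.op (y j) • c
    rw [← tensorFinsuppEquiv_tmul R, ← tensorFinsuppEquiv_tmul R]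
    exact congrArg (fun f : HomFrom R C _ => tensorFinsuppEquiv R S C J (f.toLinearMap c) j) hxy
  · intro f
    have := finite_of_hasDegreewiseFiniteResolution hC.finite_left
    have : Module.Finite R C := this
    let f' : C →ₗ[R] (J →₀ C) := (tensorFinsuppEquiv R S C J).toLinearMap ∘ₗ f.toLinearMap
    obtain ⟨F, hF⟩ := exists_support_subset_of_finite f'
    choose s hs using fun j => hC.homothety_right.2 (Finsupp.lapply (R := R) j ∘ₗ f')
    have hs' (j : J) (c : C) : MulOpposite.op (s j) • c = f' c j := congr($(hs j) c)
    classical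
    -- The cut-off makes the family finitely supported and loses nothing: the coordinates of `f'`
    -- outside `F` are zero.
    refine ⟨Finsupp.onFinset F (fun j => if j ∈ F then s j else 0) (by
      intro j hj
      by_contra hjF
      simp [hjF] at hj), LinearMap.ext fun c => (tensorFinsuppEquiv R S C J).injective ?_⟩
    ext j
    refine (tensorFinsuppEquiv_tmul R S C c _ j).trans (Eq.trans ?_ (rfl : f' c j = _))
    rw [Finsupp.onFinset_apply]
    split_ifs with hj
    · exact hs' j c
    · have : f' c j = 0 := by
        by_contra hne
        exact hj (hF c (Finsupp.mem_support_iff.2 hne))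
      simp [this]

theorem extVanish_tensor_finsupp (hC : IsSemidualizing R S C) (J : Type u) :
    ExtVanish (ModuleCat.of R C) (ModuleCat.of R (TensorOver R S C (J →₀ S))) := by
  intro i hi
  have := extVanish_finsupp hC.finite_left hC.ext_left J i hi
  exact ext_subsingleton_of_target_iso (tensorFinsuppEquiv R S C J).symm.toModuleIso

end Free

/-! ### The Auslander class along a free presentation -/

section Auslander

open Abelian

theorem exists_free_presentation {S : Type u} [Ring S] (N : ModuleCat.{u} S) :
    ∃ (J : Type u) (N₁ : ModuleCat.{u} S) (f : N₁ ⟶ ModuleCat.of S (J →₀ S))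
      (g : ModuleCat.of S (J →₀ S) ⟶ N) (w : f ≫ g = 0), (ShortComplex.mk f g w).ShortExact := by
  let g : (N →₀ S) →ₗ[S] N := Finsupp.linearCombination S id
  have hg : Function.Surjective g := Finsupp.linearCombination_id_surjective S N
  let i : ModuleCat.of S (LinearMap.ker g) ⟶ ModuleCat.of S (N →₀ S) :=
    ModuleCat.ofHom (Submodule.subtype (LinearMap.ker g))
  have w : i ≫ ModuleCat.ofHom g = 0 := by
    ext x
    exact x.2
  refine ⟨N, _, _, _, w, ?_⟩
  have : Mono (i) :=
    (ModuleCat.mono_iff_injective _).2 Subtype.val_injective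
  have : Epi (ModuleCat.ofHom g) := (ModuleCat.epi_iff_surjective _).2 hg
  exact ⟨(ShortComplex.moduleCat_exact_iff _).2 fun x hx => ⟨⟨x, hx⟩, rfl⟩⟩

variable {R S : Type u} [Ring R] [Ring S]
variable {C : Type u} [AddCommGroup C] [Module R C] [Module Sᵐᵒᵖ C] [SMulCommClass R Sᵐᵒᵖ C]

variable {J : Type u} {N N₁ : ModuleCat.{u} S} {f : N₁ ⟶ ModuleCat.of S (J →₀ S)}
  {g : ModuleCat.of S (J →₀ S) ⟶ N} {w : f ≫ g = 0} (hT : (ShortComplex.mk f g w).ShortExact)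
include hT

theorem leftExtOrthogonal_syzygy {𝒳 : ObjectProperty (ModuleCat.{u} S)}
    (hN : leftExtOrthogonal 𝒳 N) : leftExtOrthogonal 𝒳 N₁ := by
  intro X hX i hi
  have hP : Projective (ModuleCat.of S (J →₀ S)) := ModuleCat.projective_of_free Finsupp.basisSingleOne
  have : Subsingleton (Ext.{u} (ShortComplex.mk f g w).X₂ X i) :=
    ext_subsingleton_of_projective (P := ModuleCat.of S (J →₀ S)) X hi
  have : Subsingleton (Ext.{u} (ShortComplex.mk f g w).X₂ X (i + 1)) :=
    ext_subsingleton_of_projective (P := ModuleCat.of S (J →₀ S)) X (by omega)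
  exact (ext_contravariant_shift hT).1 (hN X hX (i + 1) (by omega))

theorem tensor_shortExact (hN : leftExtOrthogonal (cInjective R S C) N) :
    ((ShortComplex.mk f g w).map (tensorFunctor R S C)).ShortExact := by
  have hg : Function.Surjective g.hom := (ModuleCat.epi_iff_surjective _).1 hT.epi_g
  have hfg : Function.Exact f.hom g.hom := (ShortComplex.ShortExact.moduleCat_exact_iff_function_exact _).1 hT.exact
  have hepi : Epi ((tensorFunctor R S C).map g) :=
    (ModuleCat.epi_iff_surjective _).2 (TensorOver.map_surjective g.hom hg)
  -- The adjoint of an embedding of `C ⊗ N₁` in an injective extends along `f`, as `Ext^1(N,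
  -- Hom_R(C, I)) = 0`; so the embedding factors through `C ⊗ f`.
  have hmono : Mono ((tensorFunctor R S C).map f) := by
    let E := (tensorFunctor R S C).obj N₁
    have : Subsingleton (Ext.{u} (ShortComplex.mk f g w).X₃
        (ModuleCat.of S (HomFrom R C (Injective.under E : ModuleCat.{u} R))) 1) :=
      hN _ ⟨_, inferInstance, ⟨Iso.refl _⟩⟩ 1 le_rfl
    obtain ⟨k, hk⟩ := ext_one_extend hT
      (ModuleCat.ofHom (TensorOver.curry (Injective.ι E).hom))
    have h : (tensorFunctor R S C).map f ≫ ModuleCat.ofHom (TensorOver.lift k.hom) =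
        Injective.ι E := by
      ext : 1
      apply TensorOver.curry_injective
      exact congrArg ModuleCat.Hom.hom hk
    exact mono_of_mono_fac h
  exact { exact := (ShortComplex.moduleCat_exact_iff _).2 (TensorOver.map_exact f.hom g.hom hfg hg)
          mono_f := hmono
          epi_g := hepi }

theorem ext_tensor_syzygy_iff (hC : IsSemidualizing R S C)
    (hN : leftExtOrthogonal (cInjective R S C) N) {i : ℕ} (hi : 1 ≤ i) :
    Subsingleton (Ext.{u} (ModuleCat.of R C) (ModuleCat.of R (TensorOver R S C N₁)) (i + 1)) ↔
      Subsingleton (Ext.{u} (ModuleCat.of R C) (ModuleCat.of R (TensorOver R S C N)) i) := by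
  have : Subsingleton (Ext.{u} (ModuleCat.of R C)
      ((ShortComplex.mk f g w).map (tensorFunctor R S C)).X₂ i) :=
    extVanish_tensor_finsupp hC J i hi
  have : Subsingleton (Ext.{u} (ModuleCat.of R C)
      ((ShortComplex.mk f g w).map (tensorFunctor R S C)).X₂ (i + 1)) :=
    extVanish_tensor_finsupp hC J (i + 1) (by omega)
  exact ext_covariant_shift (tensor_shortExact hT hN)

/-- Every map `C → C ⊗ F` is `μ_F(q)` for some `q`, so the maps `C → C ⊗ N` that lift to `C ⊗ F` are
exactly the `μ_N(g q)`. -/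
theorem valuationHom_surjective_iff (hC : IsSemidualizing R S C)
    (hN : leftExtOrthogonal (cInjective R S C) N) :
    Function.Surjective (valuationHom R S C N) ↔
      Subsingleton (Ext.{u} (ModuleCat.of R C) (ModuleCat.of R (TensorOver R S C N₁)) 1) := by
  have hg : Function.Surjective g.hom := (ModuleCat.epi_iff_surjective _).1 hT.epi_g
  have : Subsingleton (Ext.{u} (ModuleCat.of R C)
      ((ShortComplex.mk f g w).map (tensorFunctor R S C)).X₂ 1) :=
    extVanish_tensor_finsupp hC J 1 le_rfl
  refine Iff.trans ?_ (ext_one_subsingleton_iff_lift (tensor_shortExact hT hN)).symm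
  constructor
  · intro hμ φ
    obtain ⟨x, hx⟩ := hμ φ.hom
    obtain ⟨q, rfl⟩ := hg x
    exact ⟨ModuleCat.ofHom (valuationHom R S C (J →₀ S) q).toLinearMap, ModuleCat.hom_ext hx⟩
  · intro hlift φ
    obtain ⟨ψ, hψ⟩ := hlift (ModuleCat.ofHom φ.toLinearMap)
    obtain ⟨q, hq⟩ := (valuationHom_finsupp_bijective hC J).2 ψ.hom
    refine ⟨g.hom q, LinearMap.ext fun c => ?_⟩
    refine Eq.trans ?_ congr($hψ c)
    exact congrArg (fun t : HomFrom R C _ => TensorOver.map R C g.hom (t.toLinearMap c)) hq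

/-- By naturality the injective map `μ_F ∘ f` factors through `μ_{N₁}`. -/
theorem valuationHom_syzygy_injective (hC : IsSemidualizing R S C) :
    Function.Injective (valuationHom R S C N₁) := by
  have hf : Function.Injective f.hom := (ModuleCat.mono_iff_injective _).1 hT.mono_f
  intro x y hxy
  refine hf ((valuationHom_finsupp_bijective hC J).1 (LinearMap.ext fun c => ?_))
  exact congrArg (fun t : HomFrom R C _ => TensorOver.map R C f.hom (t.toLinearMap c)) hxy

theorem valuationHom_injective_iff (hC : IsSemidualizing R S C)
    (hN : leftExtOrthogonal (cInjective R S C) N) :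
    Function.Injective (valuationHom R S C N) ↔ Function.Surjective (valuationHom R S C N₁) := by
  have hg : Function.Surjective g.hom := (ModuleCat.epi_iff_surjective _).1 hT.epi_g
  have hfg : ∀ q, g.hom q = 0 → ∃ y, f.hom y = q :=
    (ShortComplex.moduleCat_exact_iff _).1 hT.exact
  have hgf (y : N₁) : g.hom (f.hom y) = 0 := congr($w y)
  have hT' := tensor_shortExact hT hN
  have hf' : Function.Injective (TensorOver.map R C f.hom) :=
    (ModuleCat.mono_iff_injective _).1 hT'.mono_f
  have hfg' : ∀ t, TensorOver.map R C g.hom t = 0 → ∃ y, TensorOver.map R C f.hom y = t :=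
    (ShortComplex.moduleCat_exact_iff _).1 hT'.exact
  have hgf' (t) : TensorOver.map R C g.hom (TensorOver.map R C f.hom t) = 0 :=
    congr($(((ShortComplex.mk f g w).map (tensorFunctor R S C)).zero) t)
  constructor
  · intro hμ φ
    -- Push `φ` into `C ⊗ F` and write it as `μ_F(q)`; then `μ_N(g q) = 0`, so `q` comes from `N₁`.
    obtain ⟨q, hq⟩ := (valuationHom_finsupp_bijective hC J).2
      (TensorOver.map R C f.hom ∘ₗ φ.toLinearMap)
    have hq' (c : C) : TensorOver.tmul R S c q = TensorOver.map R C f.hom (φ.toLinearMap c) :=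
      congrArg (fun t : HomFrom R C _ => t.toLinearMap c) hq
    have h0 : g.hom q = 0 := hμ (by
      rw [map_zero]
      refine LinearMap.ext fun c => ?_
      change TensorOver.map R C g.hom (TensorOver.tmul R S c q) = 0
      rw [hq', hgf'])
    obtain ⟨y, rfl⟩ := hfg q h0
    exact ⟨y, LinearMap.ext fun c => hf' (hq' c)⟩
  · intro hμ
    rw [injective_iff_map_eq_zero]
    intro x hx
    obtain ⟨q, rfl⟩ := hg x
    have hx' (c : C) : TensorOver.map R C g.hom (TensorOver.tmul R S c q) = 0 :=
      congrArg (fun t : HomFrom R C _ => t.toLinearMap c) hx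
    -- Since `μ_N(g q) = 0`, `μ_F(q)` takes values in `C ⊗ N₁`, hence equals `μ_{N₁}(y)` there for
    -- some `y`; injectivity of `μ_F` gives `f y = q`.
    have hrange : ∀ c, (valuationHom R S C (J →₀ S) q).toLinearMap c ∈
        LinearMap.range (TensorOver.map R C f.hom) := fun c => hfg' _ (hx' c)
    let e := LinearEquiv.ofInjective _ hf'
    obtain ⟨y, hy⟩ := hμ (e.symm.toLinearMap ∘ₗ
      (valuationHom R S C (J →₀ S) q).toLinearMap.codRestrict _ hrange)
    have hy' : f.hom y = q := (valuationHom_finsupp_bijective hC J).1 (LinearMap.ext fun c => by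
      have h := congrArg (fun t : HomFrom R C _ => (e (t.toLinearMap c)).1) hy
      refine Eq.trans h ?_
      change (e (e.symm _)).1 = _
      rw [e.apply_symm_apply]
      rfl)
    rw [← hy', hgf]

theorem isAuslander_of_syzygy (hC : IsSemidualizing R S C)
    (hN : leftExtOrthogonal (cInjective R S C) N) (hN₁ : IsAuslander R S C N₁) :
    IsAuslander R S C N where
  tor := by rwa [torOrthogonal_eq_leftExtOrthogonal_cInjective]
  ext i hi := (ext_tensor_syzygy_iff hT hC hN hi).1 (hN₁.ext (i + 1) (by omega))
  valuation := ⟨(valuationHom_injective_iff hT hC hN).2 hN₁.valuation.2,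
    (valuationHom_surjective_iff hT hC hN).2 (hN₁.ext 1 le_rfl)⟩

omit hT

/-- `N'` is an `m`-th syzygy. Bijectivity of `μ` passes to syzygies, and each step adds one degree
of vanishing: surjectivity of `μ` supplies degree 1, while the earlier vanishing moves up by one. -/
theorem exists_iterated_syzygy (hC : IsSemidualizing R S C) (m : ℕ) {N : ModuleCat.{u} S}
    (hN : leftExtOrthogonal (cInjective R S C) N)
    (hμ : Function.Bijective (valuationHom R S C N)) :
    ∃ N' : ModuleCat.{u} S, leftExtOrthogonal (cInjective R S C) N' ∧
      Function.Bijective (valuationHom R S C N') ∧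
      (∀ i, 1 ≤ i →
        (Subsingleton (Ext.{u} (ModuleCat.of R C) (ModuleCat.of R (TensorOver R S C N')) (i + m)) ↔
          Subsingleton (Ext.{u} (ModuleCat.of R C) (ModuleCat.of R (TensorOver R S C N)) i))) ∧
      ∀ i, 1 ≤ i → i ≤ m →
        Subsingleton (Ext.{u} (ModuleCat.of R C) (ModuleCat.of R (TensorOver R S C N')) i) := by
  induction m with
  | zero => exact ⟨N, hN, hμ, fun i _ => Iff.rfl, fun i h h' => by omega⟩
  | succ m ih =>
    obtain ⟨N', hN', hμ', hshift, hvan⟩ := ih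
    obtain ⟨J, N₁, f, g, w, hT⟩ := exists_free_presentation N'
    refine ⟨N₁, leftExtOrthogonal_syzygy hT hN', ⟨valuationHom_syzygy_injective hT hC,
      (valuationHom_injective_iff hT hC hN').1 hμ'.1⟩, fun i hi => ?_, fun i hi him => ?_⟩
    · rw [← hshift i hi, ← add_assoc, ext_tensor_syzygy_iff hT hC hN' (by omega)]
    · obtain ⟨i, rfl⟩ := Nat.exists_eq_add_of_le' hi
      rcases Nat.eq_zero_or_pos i with rfl | hi'
      · exact (valuationHom_surjective_iff hT hC hN').1 hμ'.2
      · exact (ext_tensor_syzygy_iff hT hC hN' hi').2 (hvan i hi' (by omega))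

theorem isAuslander_of_valuationHom_bijective (hC : IsSemidualizing R S C)
    (hcl : HasUltimatelyClosedResolution (ModuleCat.of R C)) {N : ModuleCat.{u} S}
    (hN : leftExtOrthogonal (cInjective R S C) N)
    (hμ : Function.Bijective (valuationHom R S C N)) : IsAuslander R S C N := by
  obtain ⟨n, hn⟩ := hcl
  obtain ⟨N', -, -, hshift, hvan⟩ := exists_iterated_syzygy hC n hN hμ
  refine ⟨by rwa [torOrthogonal_eq_leftExtOrthogonal_cInjective], fun i hi => ?_, hμ⟩
  -- The number of syzygies is the `n` of ultimate closedness, so vanishing in degrees `1` to `n` is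
  -- just what is required.
  exact (hshift i hi).1 (extVanish_of_ultimatelyClosed hn _ hvan (i + n) (by omega))

theorem isAuslander_of_leftExtOrthogonal_cInjective (hC : IsSemidualizing R S C)
    (hcl : HasUltimatelyClosedResolution (ModuleCat.of R C)) {N : ModuleCat.{u} S}
    (hN : leftExtOrthogonal (cInjective R S C) N) : IsAuslander R S C N := by
  obtain ⟨J, N₁, f, g, w, hT⟩ := exists_free_presentation N
  have hN₁ := leftExtOrthogonal_syzygy hT hN
  obtain ⟨J', N₂, f', g', w', hT'⟩ := exists_free_presentation N₁
  have hN₂ := leftExtOrthogonal_syzygy hT' hN₁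
  -- Two syzygies suffice: `N₁` embeds in a free module, so `μ_{N₁}` is injective, which makes
  -- `μ_{N₂}` surjective.
  have hμ : Function.Bijective (valuationHom R S C N₂) :=
    ⟨valuationHom_syzygy_injective hT' hC,
      (valuationHom_injective_iff hT' hC hN₁).1 (valuationHom_syzygy_injective hT hC)⟩
  exact isAuslander_of_syzygy hT hC hN (isAuslander_of_syzygy hT' hC hN₁
    (isAuslander_of_valuationHom_bijective hC hcl hN₂ hμ))

end Auslander

theorem theorem4p10 (R S : Type u) [Ring R] [Ring S]
    (C : Type u) [AddCommGroup C] [Module R C] [Module Sᵐᵒᵖ C] [SMulCommClass R Sᵐᵒᵖ C]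
    (hC : IsSemidualizing R S C)
    (hcl : HasUltimatelyClosedResolution (ModuleCat.of R C)) :
    auslanderClass R S C = torOrthogonal R S C ∧
      torOrthogonal R S C = leftExtOrthogonal (cInjective R S C) := by
  refine ⟨?_, torOrthogonal_eq_leftExtOrthogonal_cInjective R S C⟩
  ext N
  refine ⟨fun h => h.tor, fun h => ?_⟩
  rw [torOrthogonal_eq_leftExtOrthogonal_cInjective] at h
  exact isAuslander_of_leftExtOrthogonal_cInjective hC hcl h
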